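/- A finite metric space is understood to be non-empty, and $\mathcal M$ denotes the collection of all finite metric spaces. For $X,Y\in\mathcal M$ let $$d_{\mathrm{GH}}(X,Y)=\tfrac12\min_R\ \max_{(x,y),(x',y')\in R}|d_X(x,x')-d_Y(y,y')|,$$ where $R$ ranges over all correspondences between $X$ and $Y$ (relations $R\subseteq X\times Y$ whose projections to $X$ and to $Y$ are both surjective). For a set $X$ let $\mathrm{pow}(X)$ be the set of its finite non-empty subsets. A filtration on a finite set $X$ is a map $\phi:\mathrm{pow}(X)\to[0,\infty)$ with $\phi(\tau)\le\phi(\sigma)$ whenever $\tau\subseteq\sigma$. For filtrations $\phi_X$ on $X$ and $\phi_Y$ on $Y$ put $$d_{\mathcal F}(\phi_X,\phi_Y)=\inf_{Z,\pi_X,\pi_Y}\ \max_{\sigma\in\mathrm{pow}(Z)}|\phi_X(\pi_X(\sigma))-\phi_Y(\pi_Y(\sigma))|,$$ the infimum being over all finite sets $Z$ with surjections $\pi_X:Z\to X$ and $\pi_Y:Z\to Y$. A filtration functor is a map $\Phi$ assigning to every $X\in\mathcal M$ a filtration $\Phi_X$ on $X$. It is $1$-stable if $d_{\mathcal F}(\Phi_X,\Phi_Y)\le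 d_{\mathrm{GH}}(X,Y)$ for all $X,Y\in\mathcal M$. Fix a coefficient field. For a filtration $\phi$ on a finite set, let $\mathrm{dgm}_0(\phi)$ be the barcode of the persistent vector space $t\mapsto \mathrm H_0(\{\sigma:\phi(\sigma)\le t\})$, $t\in\mathbb R$, with maps induced by inclusions: that is, the unique finite multiset of intervals $[b,d)$, $b<d\le\infty$, such that this persistent vector space is isomorphic to the direct sum of the corresponding interval modules. Let $d_{\mathrm B}$ be the bottleneck distance between barcodes: the infimum, over all partial matchings of the bars, of the maximal cost, with values in $[0,\infty]$; matching $[b,d)$ with $[b',d')$ costs $\max(|b-b'|,|d-d'|)$ (where $|\infty-\infty|=0$ and $|\infty-r|=\infty$ for real $r$), and leaving $[b,d)$ unmatched costs $(d-b)/2$. Theorem. There is a family $\mathfrak F$ of $1$-stable filtration functors such that, for every coefficient field and all $X,Y\in\mathcal M$, $$d_{\mathrm{GH}}(X,Y)=\sup_{\Phi\in\mathfrak F} d_{\mathrm B}\big(\mathrm{dgm}_0(\Phi_X),\mathrm{dgm}_0(\Phi_Y)\big).$$ Moreover, one may take $\mathfrak F=\{\Upsilon^{(Z)}: Z\in\mathcal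 M\}$, where $\Upsilon^{(Z)}_X(\sigma)=d_{\mathrm{GH}}(X,Z)$ for all $X\in\mathcal M$ and $\sigma\in\mathrm{pow}(X)$. -/

import Mathlib

open scoped NNReal ENNReal

universe u v w w'

noncomputable section

namespace PersistentGH

/-! ### Finite metric spaces and the Gromov-Hausdorff distance -/

/-- The collection of all (non-empty) finite metric spaces. -/
structure FinMetricSpace : Type (u + 1) where
  carrier : Type u
  [metricSpace : MetricSpace carrier]
  [finite : Finite carrier]
  [nonempty : Nonempty carrier]

namespace FinMetricSpace

instance : CoeSort FinMetricSpace.{u} (Type u) := ⟨FinMetricSpace.carrier⟩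

instance (X : FinMetricSpace.{u}) : MetricSpace X := X.metricSpace
instance (X : FinMetricSpace.{u}) : Finite X := X.finite
instance (X : FinMetricSpace.{u}) : Nonempty X := X.nonempty

end FinMetricSpace

/-- A correspondence: a relation both of whose coordinate projections are surjective. -/
def IsCorrespondence {X : Type u} {Y : Type v} (R : Set (X × Y)) : Prop :=
  (∀ x, ∃ y, (x, y) ∈ R) ∧ (∀ y, ∃ x, (x, y) ∈ R)

/-- The distortion of a relation (a maximum, for non-empty relations between finite spaces). -/
def distortion {X : Type u} {Y : Type v} [MetricSpace X] [MetricSpace Y] (R : Set (X × Y)) : ℝ :=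
  sSup {r | ∃ p ∈ R, ∃ q ∈ R, r = |dist p.1 q.1 - dist p.2 q.2|}

/-- The Gromov-Hausdorff distance: half the minimal distortion of a correspondence. -/
def dGH (X Y : FinMetricSpace.{u}) : ℝ :=
  (1 / 2) * sInf {r | ∃ R : Set (X × Y), IsCorrespondence R ∧ r = distortion R}

theorem distortion_nonneg {X : Type u} {Y : Type v} [MetricSpace X] [MetricSpace Y]
    (R : Set (X × Y)) : 0 ≤ distortion R := by
  apply Real.sSup_nonneg
  rintro r ⟨p, _, q, _, rfl⟩
  exact abs_nonneg _

theorem dGH_nonneg (X Y : FinMetricSpace.{u}) : 0 ≤ dGH X Y := by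
  refine mul_nonneg (by norm_num) (Real.sInf_nonneg ?_)
  rintro r ⟨R, _, rfl⟩
  exact distortion_nonneg R

/-! ### Filtrations and filtration functors -/

/-- `Pow X` is the set of all finite non-empty subsets of `X`. -/
abbrev Pow (X : Type u) : Type u := {σ : Finset X // σ.Nonempty}

open Classical in
/-- The image of a finite non-empty subset under a map. -/
def Pow.image {X : Type u} {Y : Type v} (f : X → Y) (σ : Pow X) : Pow Y :=
  ⟨σ.1.image f, σ.2.image f⟩

/-- A filtration on a set `X`: a monotone non-negative function on `Pow X`. -/
structure Filtration (X : Type u) where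
  toFun : Pow X → ℝ
  nonneg : ∀ σ, 0 ≤ toFun σ
  mono : ∀ τ σ : Pow X, τ.1 ⊆ σ.1 → toFun τ ≤ toFun σ

instance (X : Type u) : CoeFun (Filtration X) (fun _ => Pow X → ℝ) := ⟨Filtration.toFun⟩

/-- The distance between filtered spaces: the infimum, over all finite sets `Z` with surjections
`πX : Z → X` and `πY : Z → Y`, of the maximum over `σ ∈ Pow Z` of
`|φX (πX σ) - φY (πY σ)|`. -/
def dFilt {X Y : Type u} (φX : Filtration X) (φY : Filtration Y) : ℝ≥0∞ :=
  ⨅ (Z : Type u) (_ : Finite Z) (πX : Z → X) (πY : Z → Y)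
    (_ : Function.Surjective πX) (_ : Function.Surjective πY),
    ⨆ σ : Pow Z, ENNReal.ofReal |φX (σ.image πX) - φY (σ.image πY)|

/-- A filtration functor assigns to every finite metric space a filtration on it. -/
def FiltrationFunctor : Type (u + 1) := ∀ X : FinMetricSpace.{u}, Filtration X

/-- `L`-stability of a filtration functor. -/
def IsStable (L : ℝ≥0) (Φ : FiltrationFunctor.{u}) : Prop :=
  ∀ X Y : FinMetricSpace.{u}, dFilt (Φ X) (Φ Y) ≤ L * ENNReal.ofReal (dGH X Y)

/-- The filtration functor `Υ^{(Z)}` whose value on every simplex of `X` is `d_GH(X, Z)`. -/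
def upsilon (Z : FinMetricSpace.{u}) : FiltrationFunctor.{u} := fun X =>
  { toFun := fun _ => dGH X Z
    nonneg := fun _ => dGH_nonneg X Z
    mono := fun _ _ _ => le_rfl }

/-- The simplicial complex `{σ | φ σ ≤ t}` of a filtration at time `t`. -/
def Filtration.complex {X : Type u} (φ : Filtration X) (t : ℝ) : PreAbstractSimplicialComplex X where
  faces := {σ | ∃ h : σ.Nonempty, φ ⟨σ, h⟩ ≤ t}
  isRelLowerSet_faces := by
    rintro σ ⟨h, hσ⟩
    exact ⟨h, fun τ hτσ hτ => ⟨hτ, (φ.mono ⟨τ, hτ⟩ ⟨σ, h⟩ hτσ).trans hσ⟩⟩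

theorem Filtration.complex_mono {X : Type u} (φ : Filtration X) {s t : ℝ} (hst : s ≤ t) :
    (φ.complex s).faces ⊆ (φ.complex t).faces := fun _ ⟨h, hσ⟩ => ⟨h, hσ.trans hst⟩

/-! ### Simplicial homology in degree zero -/

section Homology

variable (F : Type v) [Field F] {X : Type u}

/-- The vertices of a simplicial complex. -/
abbrev Vertex (K : PreAbstractSimplicialComplex X) : Type u := {x : X // {x} ∈ K.faces}

/-- The `0`-chains: the vector space with basis the vertices. -/
abbrev Chain0 (K : PreAbstractSimplicialComplex X) : Type (max u v) := Vertex K →₀ F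

open Classical in
/-- The `0`-boundaries: the span of the boundaries `y - x` of the edges `{x, y}`
(the case `x = y` contributes only the zero chain). -/
def boundaries0 (K : PreAbstractSimplicialComplex X) : Submodule F (Chain0 F K) :=
  Submodule.span F {c | ∃ x y : Vertex K, ({x.1, y.1} : Finset X) ∈ K.faces ∧
    c = Finsupp.single y 1 - Finsupp.single x 1}

/-- `H₀(K; F)`: all `0`-chains are cycles, so this is `0`-chains modulo `0`-boundaries. -/
abbrev H0 (K : PreAbstractSimplicialComplex X) : Type (max u v) := Chain0 F K ⧸ boundaries0 F K

/-- The chain map in degree `0` induced by an inclusion of complexes. -/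
def chain0Map {K L : PreAbstractSimplicialComplex X} (h : K.faces ⊆ L.faces) :
    Chain0 F K →ₗ[F] Chain0 F L :=
  Finsupp.lmapDomain F F (fun x : Vertex K => (⟨x.1, h x.2⟩ : Vertex L))

theorem boundaries0_le_comap {K L : PreAbstractSimplicialComplex X} (h : K.faces ⊆ L.faces) :
    boundaries0 F K ≤ (boundaries0 F L).comap (chain0Map F h) := by
  refine Submodule.span_le.2 ?_
  rintro c ⟨x, y, hxy, rfl⟩
  refine Submodule.subset_span ⟨⟨x.1, h x.2⟩, ⟨y.1, h y.2⟩, h hxy, ?_⟩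
  rw [map_sub]
  simp [chain0Map, Finsupp.mapDomain_single]

/-- The map in `H₀` induced by an inclusion of complexes. -/
def H0Map {K L : PreAbstractSimplicialComplex X} (h : K.faces ⊆ L.faces) :
    H0 F K →ₗ[F] H0 F L :=
  Submodule.mapQ _ _ (chain0Map F h) (boundaries0_le_comap F h)

end Homology

/-! ### Persistent vector spaces and barcodes -/

/-- A persistent vector space over the field `F`, indexed by the real line. -/
structure PersistentVectorSpace (F : Type v) [Field F] where
  space : ℝ → Type w
  [addCommGroup : ∀ t, AddCommGroup (space t)]
  [module : ∀ t, Module F (space t)]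
  map : ∀ {s t : ℝ}, s ≤ t → (space s →ₗ[F] space t)
  map_id : ∀ t, map (le_refl t) = LinearMap.id
  map_comp : ∀ {r s t : ℝ} (hrs : r ≤ s) (hst : s ≤ t), map (hrs.trans hst) = map hst ∘ₗ map hrs

attribute [instance] PersistentVectorSpace.addCommGroup PersistentVectorSpace.module

/-- An isomorphism of persistent vector spaces. -/
structure PersistentVectorSpace.Iso {F : Type v} [Field F]
    (U : PersistentVectorSpace.{v, w} F) (V : PersistentVectorSpace.{v, w'} F) where
  equiv : ∀ t, U.space t ≃ₗ[F] V.space t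
  comm : ∀ {s t : ℝ} (hst : s ≤ t) (x : U.space s),
    equiv t (U.map hst x) = V.map hst (equiv s x)

/-- The (direct) sum of a finite family of persistent vector spaces. -/
def PersistentVectorSpace.sum {F : Type v} [Field F] {n : ℕ}
    (V : Fin n → PersistentVectorSpace.{v, w} F) : PersistentVectorSpace.{v, w} F where
  space t := ∀ i, (V i).space t
  map hst := LinearMap.pi fun i => (V i).map hst ∘ₗ LinearMap.proj i
  map_id t := by
    refine LinearMap.ext fun x => funext fun i => ?_
    simp [(V i).map_id]
  map_comp hrs hst := by
    refine LinearMap.ext fun x => funext fun i => ?_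
    simp [(V i).map_comp hrs hst]

/-- The bars: the intervals `[b, d)` with `b < d`, and the intervals `[b, ∞)`. -/
inductive Bar : Type
  | finite (b d : ℝ) (h : b < d)
  | infinite (b : ℝ)

/-- The set of times covered by a bar. -/
def Bar.toSet : Bar → Set ℝ
  | .finite b d _ => Set.Ico b d
  | .infinite b => Set.Ici b

theorem Bar.ordConnected (I : Bar) : I.toSet.OrdConnected := by
  cases I
  · exact Set.ordConnected_Ico
  · exact Set.ordConnected_Ici

/-- The subspace of `F` which is all of `F` if the time `t` belongs to the bar, and zero if not. -/
def Bar.fiber (F : Type v) [Field F] (I : Bar) (t : ℝ) : Submodule F F where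
  carrier := {a | t ∉ I.toSet → a = 0}
  add_mem' ha hb h := by simp [ha h, hb h]
  zero_mem' _ := rfl
  smul_mem' c a ha h := by simp [ha h]

open Classical in
/-- The interval module of a bar `I`: the field `F` at times in `I` and zero at all other times,
with identity maps between times in `I` and zero maps otherwise. -/
def intervalModule (F : Type v) [Field F] (I : Bar) : PersistentVectorSpace.{v, v} F where
  space t := I.fiber F t
  map {s t} _ := LinearMap.codRestrict (I.fiber F t)
    ((if t ∈ I.toSet then LinearMap.id else 0) ∘ₗ Submodule.subtype (I.fiber F s))
    (fun x h => by simp [h])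
  map_id t := by
    refine LinearMap.ext fun ⟨x, hx⟩ => Subtype.ext ?_
    by_cases h : t ∈ I.toSet
    · simp [h]
    · simp [h, hx h]
  map_comp {r s t} hrs hst := by
    refine LinearMap.ext fun ⟨x, hx⟩ => Subtype.ext ?_
    by_cases hr : r ∈ I.toSet
    · by_cases ht : t ∈ I.toSet
      · have hs : s ∈ I.toSet := I.ordConnected.out hr ht ⟨hrs, hst⟩
        simp [hs, ht]
      · simp [ht]
    · by_cases ht : t ∈ I.toSet <;> by_cases hs : s ∈ I.toSet <;> simp [ht, hs, hx hr]

/-- A barcode (persistence diagram): a finite multiset of bars. -/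
abbrev Barcode : Type := Multiset Bar

/-- `D` is a barcode of `U` if `U` is isomorphic to the direct sum of the interval modules of the
bars in `D`, counted with multiplicity. -/
def IsBarcodeOf {F : Type v} [Field F] (D : Barcode) (U : PersistentVectorSpace.{v, w} F) : Prop :=
  ∃ (n : ℕ) (I : Fin n → Bar), D = Finset.univ.val.map I ∧
    Nonempty (U.Iso (PersistentVectorSpace.sum fun i => intervalModule F (I i)))

open Classical in
/-- The diagram map. The barcode of a persistent vector space is unique if it exists, and it exists
for the homology of every filtration on a finite set; the value is the empty barcode otherwise. -/
def dgm {F : Type v} [Field F] (U : PersistentVectorSpace.{v, w} F) : Barcode :=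
  if h : ∃ D : Barcode, IsBarcodeOf D U then h.choose else 0

/-- The persistent vector space `t ↦ H₀(φ[t]; F)` of a filtration `φ`. -/
def persistentH0 (F : Type v) [Field F] {X : Type u} (φ : Filtration X) :
    PersistentVectorSpace.{v, max u v} F where
  space t := H0 F (φ.complex t)
  map hst := H0Map F (φ.complex_mono hst)
  map_id t := by
    ext x
    simp [H0Map, chain0Map]
  map_comp hrs hst := by
    ext x
    simp [H0Map, chain0Map, Finsupp.mapDomain_single]

/-- The `0`-dimensional persistence diagram, with coefficients in `F`, of a filtration. -/
def dgm0 (F : Type v) [Field F] {X : Type u} (φ : Filtration X) : Barcode :=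
  dgm (persistentH0 F φ)

/-! ### The bottleneck distance -/

/-- The `ℓ^∞` distance between two bars, regarded as points `(b, d)` with `d ≤ ∞`. -/
def Bar.cost : Bar → Bar → ℝ≥0∞
  | .finite b d _, .finite b' d' _ => ENNReal.ofReal (max |b - b'| |d - d'|)
  | .infinite b, .infinite b' => ENNReal.ofReal |b - b'|
  | _, _ => ⊤

/-- The `ℓ^∞` distance from a bar to the diagonal: half of its length. -/
def Bar.diagonalCost : Bar → ℝ≥0∞
  | .finite b d _ => ENNReal.ofReal ((d - b) / 2)
  | .infinite _ => ⊤

/-- The bottleneck distance: the infimum over all partial matchings between `D` and `D'` of the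
maximal cost. Here `M` is the multiset of matched pairs, and `A`, `A'` are the multisets of
unmatched bars of `D`, `D'`, which are matched to the diagonal. -/
def dB (D D' : Barcode) : ℝ≥0∞ :=
  ⨅ (M : Multiset (Bar × Bar)) (A : Multiset Bar) (A' : Multiset Bar)
    (_ : D = M.map Prod.fst + A) (_ : D' = M.map Prod.snd + A'),
    (⨆ p ∈ M, Bar.cost p.1 p.2) ⊔ (⨆ a ∈ A, Bar.diagonalCost a) ⊔ (⨆ a ∈ A', Bar.diagonalCost a)

end PersistentGH

end

noncomputable section

namespace PersistentGH

/-! ### The Gromov-Hausdorff distance is a pseudometric -/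

/-! The family is a Kuratowski embedding in disguise. A constant filtration with value `c` has an
empty complex before time `c` and a full simplex from `c` on, so its degree-zero barcode is the
single bar `[c, ∞)`, over every field (`dgm0_of_const`). An infinite bar cannot be left unmatched at
finite cost, so two such bars are at bottleneck distance `|a - b|` (`dB_infinite`). The supremum is
therefore that of `|dGH X Z - dGH Y Z|` over `Z`: the triangle inequality bounds it by `dGH X Y`,
and `Z = Y` attains the bound. The same inequality gives stability.

Since `dgm` chooses a decomposition, computing it requires uniqueness of barcodes; only the case of
one infinite bar is needed (`sum_intervalModule_eq`). -/

theorem abs_le_distortion {X : Type u} {Y : Type v} [MetricSpace X] [MetricSpace Y]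
    [Finite X] [Finite Y] {R : Set (X × Y)} {p q : X × Y} (hp : p ∈ R) (hq : q ∈ R) :
    |dist p.1 q.1 - dist p.2 q.2| ≤ distortion R := by
  refine le_csSup (Set.Finite.bddAbove ?_) ⟨p, hp, q, hq, rfl⟩
  refine (Set.finite_range fun z : (X × Y) × (X × Y) =>
    |dist z.1.1 z.2.1 - dist z.1.2 z.2.2|).subset ?_
  rintro r ⟨p, _, q, _, rfl⟩
  exact ⟨(p, q), rfl⟩

theorem distortion_le {X : Type u} {Y : Type v} [MetricSpace X] [MetricSpace Y]
    {R : Set (X × Y)} {c : ℝ} (hc : 0 ≤ c)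
    (h : ∀ p ∈ R, ∀ q ∈ R, |dist p.1 q.1 - dist p.2 q.2| ≤ c) : distortion R ≤ c := by
  refine Real.sSup_le ?_ hc
  rintro r ⟨p, hp, q, hq, rfl⟩
  exact h p hp q hq

theorem dGH_le (X Y : FinMetricSpace.{u}) {R : Set (X × Y)} (hR : IsCorrespondence R) :
    dGH X Y ≤ 1 / 2 * distortion R := by
  refine mul_le_mul_of_nonneg_left (csInf_le ⟨0, ?_⟩ ⟨R, hR, rfl⟩) (by norm_num)
  rintro r ⟨R, _, rfl⟩
  exact distortion_nonneg R

theorem exists_dGH_eq (X Y : FinMetricSpace.{u}) :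
    ∃ R : Set (X × Y), IsCorrespondence R ∧ dGH X Y = 1 / 2 * distortion R := by
  have hne : {r | ∃ R : Set (X × Y), IsCorrespondence R ∧ r = distortion R}.Nonempty :=
    ⟨_, Set.univ, ⟨fun _ => ⟨Classical.arbitrary Y, trivial⟩,
      fun _ => ⟨Classical.arbitrary X, trivial⟩⟩, rfl⟩
  have hfin : {r | ∃ R : Set (X × Y), IsCorrespondence R ∧ r = distortion R}.Finite := by
    refine (Set.finite_range fun R : Set (X × Y) => distortion R).subset ?_
    rintro r ⟨R, _, rfl⟩
    exact ⟨R, rfl⟩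
  obtain ⟨R, hR, h⟩ := hne.csInf_mem hfin
  exact ⟨R, hR, by rw [dGH, h]⟩

theorem dGH_self (X : FinMetricSpace.{u}) : dGH X X = 0 := by
  refine le_antisymm ?_ (dGH_nonneg X X)
  have hR : IsCorrespondence {p : X × X | p.1 = p.2} := ⟨fun x => ⟨x, rfl⟩, fun x => ⟨x, rfl⟩⟩
  have hd : distortion {p : X × X | p.1 = p.2} ≤ 0 := by
    refine distortion_le le_rfl ?_
    intro p (hp : p.1 = p.2) q (hq : q.1 = q.2)
    rw [hp, hq, sub_self, abs_zero]
  linarith [dGH_le X X hR]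

theorem dGH_comm_le (X Y : FinMetricSpace.{u}) : dGH X Y ≤ dGH Y X := by
  obtain ⟨R, hR, h⟩ := exists_dGH_eq Y X
  have hd : distortion {p : X × Y | (p.2, p.1) ∈ R} ≤ distortion R := by
    refine distortion_le (distortion_nonneg R) fun p hp q hq => ?_
    rw [abs_sub_comm]
    exact abs_le_distortion (p := (p.2, p.1)) (q := (q.2, q.1)) hp hq
  linarith [dGH_le X Y (R := {p : X × Y | (p.2, p.1) ∈ R}) ⟨hR.2, hR.1⟩]

theorem dGH_comm (X Y : FinMetricSpace.{u}) : dGH X Y = dGH Y X :=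
  le_antisymm (dGH_comm_le X Y) (dGH_comm_le Y X)

theorem dGH_triangle (X Y Z : FinMetricSpace.{u}) : dGH X Z ≤ dGH X Y + dGH Y Z := by
  obtain ⟨R, hR, h⟩ := exists_dGH_eq X Y
  obtain ⟨S, hS, h'⟩ := exists_dGH_eq Y Z
  -- Composing optimal correspondences adds their distortions at most.
  have hT : IsCorrespondence {p : X × Z | ∃ y, (p.1, y) ∈ R ∧ (y, p.2) ∈ S} := by
    constructor
    · intro x
      obtain ⟨y, hy⟩ := hR.1 x
      obtain ⟨z, hz⟩ := hS.1 y
      exact ⟨z, y, hy, hz⟩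
    · intro z
      obtain ⟨y, hy⟩ := hS.2 z
      obtain ⟨x, hx⟩ := hR.2 y
      exact ⟨x, y, hx, hy⟩
  have hd : distortion {p : X × Z | ∃ y, (p.1, y) ∈ R ∧ (y, p.2) ∈ S} ≤
      distortion R + distortion S := by
    refine distortion_le (add_nonneg (distortion_nonneg R) (distortion_nonneg S)) ?_
    rintro ⟨x, z⟩ ⟨y, hy, hy'⟩ ⟨a, c⟩ ⟨b, hb, hb'⟩
    exact (abs_sub_le _ (dist y b) _).trans
      (add_le_add (abs_le_distortion hy hb) (abs_le_distortion hy' hb'))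
  linarith [dGH_le X Z hT]

theorem abs_dGH_sub_le (X Y Z : FinMetricSpace.{u}) : |dGH X Z - dGH Y Z| ≤ dGH X Y := by
  rw [abs_sub_le_iff]
  constructor <;> linarith [dGH_triangle X Y Z, dGH_triangle Y X Z, dGH_comm X Y]

theorem isStable_upsilon (Z : FinMetricSpace.{u}) : IsStable 1 (upsilon Z) := by
  intro X Y
  rw [ENNReal.coe_one, one_mul]
  -- The filtrations are constant, so any common cover gives the same value; the product is a
  -- convenient one.
  refine iInf_le_of_le (X × Y) <| iInf_le_of_le inferInstance <| iInf_le_of_le Prod.fst <|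
    iInf_le_of_le Prod.snd <| iInf_le_of_le Prod.fst_surjective <|
    iInf_le_of_le Prod.snd_surjective <| iSup_le fun σ => ?_
  exact ENNReal.ofReal_le_ofReal (abs_dGH_sub_le X Y Z)

/-! ### Barcodes of a single infinite bar -/

section Barcodes

variable {F : Type v} [Field F]

theorem Bar.toSet_nonempty (I : Bar) : I.toSet.Nonempty := by
  cases I with
  | finite b d h => exact ⟨b, le_rfl, h⟩
  | infinite b => exact ⟨b, le_refl b⟩

theorem Bar.eq_infinite {I : Bar} {c : ℝ} (h : I.toSet = Set.Ici c) : I = .infinite c := by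
  cases I with
  | finite b d hbd =>
    -- A finite bar cannot be a ray: this point lies in the ray but not below `d`.
    have : max c d ∈ Set.Ico b d := by
      change max c d ∈ (Bar.finite b d hbd).toSet
      rw [h]
      exact le_max_left c d
    exact absurd this.2 (not_lt.2 (le_max_right c d))
  | infinite b => rw [Set.Ici_injective h]

theorem Bar.fiber_val_eq_zero {I : Bar} {t : ℝ} (h : t ∉ I.toSet) (x : I.fiber F t) : x = 0 :=
  Subtype.ext (x.2 h)

/-- The generator of an interval module at a time in the interval. -/
def Bar.generator (F : Type v) [Field F] (I : Bar) {t : ℝ} (h : t ∈ I.toSet) : I.fiber F t :=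
  ⟨1, fun h' => absurd h h'⟩

theorem Bar.generator_ne_zero (I : Bar) {t : ℝ} (h : t ∈ I.toSet) : I.generator F h ≠ 0 :=
  fun h' => one_ne_zero (α := F) (congrArg Subtype.val h')

theorem intervalModule_map_val {I : Bar} {s t : ℝ} (hst : s ≤ t) (ht : t ∈ I.toSet)
    (x : I.fiber F s) : (I.fiber F t).subtype ((intervalModule F I).map hst x) = x := by
  simp only [intervalModule, ht, if_true]
  rfl

/-- The module of `[c, ∞)` vanishes before `c`, so no bar starts earlier. Its maps out of time `c`
are surjective, so every bar contains `c`; its fiber there is a line, so there is exactly one bar.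
Its maps out of `c` are also injective, so that bar never ends. -/
theorem sum_intervalModule_eq {n : ℕ} {I : Fin n → Bar} {c : ℝ}
    (e : (intervalModule F (.infinite c)).Iso
      (PersistentVectorSpace.sum fun i => intervalModule F (I i))) :
    Finset.univ.val.map I = {Bar.infinite c} := by
  classical
  have key : ∀ t i (h : t ∈ (I i).toSet), ∃ x : (Bar.infinite c).fiber F t,
      e.equiv t x = Pi.single (M := fun i => (I i).fiber F t) i ((I i).generator F h) :=
    fun t i h => (e.equiv t).surjective _
  have hge : ∀ i t, t ∈ (I i).toSet → c ≤ t := by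
    intro i t ht
    by_contra hc
    obtain ⟨x, hx⟩ := key t i ht
    have h0 : x = 0 := Bar.fiber_val_eq_zero hc x
    rw [h0] at hx
    have := congrFun ((map_zero (e.equiv t)).symm.trans hx) i
    rw [Pi.single_eq_same] at this
    exact (I i).generator_ne_zero (F := F) ht this.symm
  have hc : ∀ i, c ∈ (I i).toSet := by
    intro i
    obtain ⟨t, ht⟩ := (I i).toSet_nonempty
    obtain ⟨x, hx⟩ := key t i ht
    by_contra hci
    have hct := hge i t ht
    -- Lift `x` back to time `c`. If bar `i` missed `c`, the `i`-th coordinate of the lift would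
    -- vanish, and so would the generator.
    obtain ⟨z, hz⟩ : ∃ z : (Bar.infinite c).fiber F c, z.1 = x.1 :=
      ⟨⟨x.1, fun h => absurd (le_refl c) h⟩, rfl⟩
    have hy : (intervalModule F (.infinite c)).map hct z = x :=
      Subtype.ext ((intervalModule_map_val (I := .infinite c) hct hct z).trans hz)
    have h1 := e.comm hct z
    rw [hy, hx] at h1
    have h2 := congrFun h1 i
    rw [Pi.single_eq_same] at h2
    refine (I i).generator_ne_zero (F := F) ht (h2.trans ?_)
    exact (congrArg ((intervalModule F (I i)).map hct)
      (Bar.fiber_val_eq_zero hci (e.equiv c z i))).trans (map_zero _)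
  have hsub : Subsingleton (Fin n) := by
    refine ⟨fun i j => ?_⟩
    by_contra hij
    obtain ⟨x, hx⟩ := key c i (hc i)
    obtain ⟨y, hy⟩ := key c j (hc j)
    -- Two vectors on a line are proportional, but their images lie in different summands;
    -- coordinate `j` forces `x = 0`.
    have hyx : (y : F) • x = (x : F) • y := Subtype.ext (mul_comm _ _)
    have h := congrArg (e.equiv c) hyx
    have h' := ((map_smul (e.equiv c) _ _).symm.trans h).trans (map_smul (e.equiv c) _ _)
    rw [hx, hy] at h'
    have h2 : (y : F) * (Pi.single (M := fun i => (I i).fiber F c) i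
        ((I i).generator F (hc i)) j).1 = (x : F) * (Pi.single (M := fun i => (I i).fiber F c) j
        ((I j).generator F (hc j)) j).1 := congrArg Subtype.val (congrFun h' j)
    rw [Pi.single_eq_of_ne (Ne.symm hij), Pi.single_eq_same] at h2
    have hx0 : (x : F) = 0 := by simpa [Bar.generator] using h2.symm
    have hx0' : x = 0 := Subtype.ext hx0
    rw [hx0'] at hx
    have := congrFun ((map_zero (e.equiv c)).symm.trans hx) i
    rw [Pi.single_eq_same] at this
    exact (I i).generator_ne_zero (F := F) (hc i) this.symm
  have hn : Nonempty (Fin n) := by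
    by_contra hn
    rw [not_nonempty_iff] at hn
    have : (e.equiv c) ((Bar.infinite c).generator F (le_refl c)) = 0 := funext fun i => hn.elim i
    exact Bar.generator_ne_zero (F := F) _ (le_refl c)
      ((map_eq_zero_iff _ (e.equiv c).injective).1 this)
  obtain ⟨i⟩ := hn
  have hI : I i = .infinite c := by
    refine Bar.eq_infinite (Set.Subset.antisymm (fun t ht => hge i t ht) fun t ht => ?_)
    by_contra hti
    have hzero : e.equiv t ((intervalModule F (.infinite c)).map ht
        ((Bar.infinite c).generator F (le_refl c))) = 0 :=
      funext fun j => Bar.fiber_val_eq_zero (by rwa [Subsingleton.elim j i]) _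
    have h0 := (map_eq_zero_iff _ (e.equiv t).injective).1 hzero
    have h1 := intervalModule_map_val (F := F) (I := .infinite c) ht ht
      ((Bar.infinite c).generator F (le_refl c))
    rw [h0] at h1
    exact zero_ne_one (α := F) h1
  have : Unique (Fin n) := ⟨⟨i⟩, fun j => Subsingleton.elim j i⟩
  rw [Finset.univ_unique, Finset.singleton_val, Multiset.map_singleton,
    Subsingleton.elim default i, hI]

/-- The obvious decomposition only shows that one exists; the chosen one is then identified by
uniqueness. -/
theorem dgm_eq_singleton {U : PersistentVectorSpace.{v, w} F} {c : ℝ}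
    (e : U.Iso (intervalModule F (.infinite c))) : dgm U = {Bar.infinite c} := by
  have hex : ∃ D : Barcode, IsBarcodeOf D U := by
    refine ⟨_, 1, fun _ => .infinite c, rfl, ⟨⟨fun t => (e.equiv t).trans
      (LinearEquiv.funUnique (Fin 1) F ((Bar.infinite c).fiber F t)).symm, ?_⟩⟩⟩
    intro s t hst x
    exact funext fun _ => e.comm hst x
  rw [dgm, dif_pos hex]
  obtain ⟨n, I, hD, ⟨e'⟩⟩ := hex.choose_spec
  rw [hD]
  refine sum_intervalModule_eq (F := F) ⟨fun t => (e.equiv t).symm.trans (e'.equiv t), ?_⟩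
  intro s t hst x
  obtain ⟨y, rfl⟩ := (e.equiv s).surjective x
  rw [← e.comm hst y]
  simpa using e'.comm hst y

end Barcodes

/-! ### The degree zero homology of a constant filtration -/

section ConstantFiltration

variable (F : Type v) [Field F] {X : Type u}

/-- The augmentation, sending the class of each vertex to `1`. -/
def augmentation (K : PreAbstractSimplicialComplex X) : H0 F K →ₗ[F] F :=
  (boundaries0 F K).liftQ (Finsupp.linearCombination F fun _ => 1) <| by
    refine Submodule.span_le.2 ?_
    rintro c ⟨x, y, _, rfl⟩
    simp

theorem augmentation_mk (K : PreAbstractSimplicialComplex X) (c : Chain0 F K) :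
    augmentation F K (Submodule.Quotient.mk c) = Finsupp.linearCombination F (fun _ => 1) c :=
  rfl

theorem augmentation_H0Map {K L : PreAbstractSimplicialComplex X} (h : K.faces ⊆ L.faces)
    (x : H0 F K) : augmentation F L (H0Map F h x) = augmentation F K x := by
  have : augmentation F L ∘ₗ H0Map F h = augmentation F K := by
    ext x
    simp [augmentation_mk, H0Map, chain0Map, Finsupp.mapDomain_single]
  exact LinearMap.congr_fun this x

/-- Every vertex is joined by an edge to a base vertex `x₀`, so sending `1` to the class of `x₀`
inverts the augmentation. -/
theorem augmentation_bijective [Nonempty X] {K : PreAbstractSimplicialComplex X}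
    (hK : ∀ σ : Finset X, σ.Nonempty → σ ∈ K.faces) :
    Function.Bijective (augmentation F K) := by
  classical
  let x₀ : Vertex K := ⟨Classical.arbitrary X, hK _ (Finset.singleton_nonempty _)⟩
  let g : F →ₗ[F] H0 F K := (boundaries0 F K).mkQ ∘ₗ Finsupp.lsingle x₀
  have hl : g ∘ₗ augmentation F K = LinearMap.id := by
    ext y
    simp only [g, augmentation_mk, LinearMap.comp_apply, Submodule.mkQ_apply,
      Finsupp.lsingle_apply, Finsupp.linearCombination_single, smul_eq_mul, mul_one,
      LinearMap.id_apply]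
    rw [Submodule.Quotient.eq]
    refine Submodule.subset_span ⟨y, x₀, ?_, rfl⟩
    convert hK {y.1, x₀.1} (Finset.insert_nonempty _ _)
  have hr : ∀ a, augmentation F K (g a) = a := by
    intro a
    simp [g, augmentation_mk]
  exact ⟨Function.LeftInverse.injective (g := g) fun x => LinearMap.congr_fun hl x,
    Function.RightInverse.surjective hr⟩

theorem H0_subsingleton {K : PreAbstractSimplicialComplex X} (hK : K.faces = ∅) :
    Subsingleton (H0 F K) := by
  have : IsEmpty (Vertex K) := ⟨fun x => by simpa [hK] using x.2⟩
  exact (Submodule.Quotient.mk_surjective (boundaries0 F K)).subsingleton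

theorem dgm0_of_const [Nonempty X] {φ : Filtration X} {c : ℝ} (hφ : ∀ σ, φ σ = c) :
    dgm0 F φ = {Bar.infinite c} := by
  have hlt : ∀ t, t ∉ (Bar.infinite c).toSet → Subsingleton (H0 F (φ.complex t)) := by
    intro t ht
    refine H0_subsingleton F (Set.eq_empty_iff_forall_notMem.2 ?_)
    rintro σ ⟨h, hσ⟩
    exact ht ((hφ _).symm.trans_le hσ)
  have hge : ∀ t, t ∈ (Bar.infinite c).toSet →
      Function.Bijective (augmentation F (φ.complex t)) := fun t ht =>
    augmentation_bijective F fun σ h => ⟨h, (hφ _).trans_le ht⟩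
  -- The augmentation commutes with inclusions, so these maps form a morphism of persistent spaces;
  -- before `c` both sides vanish.
  let f : ∀ t, H0 F (φ.complex t) →ₗ[F] (Bar.infinite c).fiber F t := fun t =>
    LinearMap.codRestrict _ (augmentation F (φ.complex t)) fun x h => by
      have := hlt t h
      rw [Subsingleton.elim x 0, map_zero]
  have hf : ∀ t, Function.Bijective (f t) := by
    intro t
    by_cases ht : t ∈ (Bar.infinite c).toSet
    · refine ⟨fun x y h => (hge t ht).1 (congrArg Subtype.val h), fun a => ?_⟩
      obtain ⟨x, hx⟩ := (hge t ht).2 a.1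
      exact ⟨x, Subtype.ext hx⟩
    · have := hlt t ht
      exact ⟨Function.injective_of_subsingleton _,
        fun a => ⟨0, by rw [map_zero, Bar.fiber_val_eq_zero ht a]⟩⟩
  refine dgm_eq_singleton ⟨fun t => LinearEquiv.ofBijective (f t) (hf t), ?_⟩
  intro s t hst x
  by_cases ht : t ∈ (Bar.infinite c).toSet
  · refine Subtype.ext (Eq.trans ?_ (intervalModule_map_val hst ht (f s x)).symm)
    exact augmentation_H0Map F _ x
  · exact (Bar.fiber_val_eq_zero ht _).trans (Bar.fiber_val_eq_zero ht _).symm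

end ConstantFiltration

/-! ### Bottleneck distance between two infinite bars -/

theorem dB_infinite (a b : ℝ) :
    dB {Bar.infinite a} {Bar.infinite b} = ENNReal.ofReal |a - b| := by
  apply le_antisymm
  · refine iInf_le_of_le {(.infinite a, .infinite b)} <| iInf_le_of_le 0 <| iInf_le_of_le 0 <|
      iInf_le_of_le (by simp) <| iInf_le_of_le (by simp) ?_
    simp [Bar.cost]
  · refine le_iInf fun M => le_iInf fun A => le_iInf fun A' => le_iInf fun h => le_iInf fun h' => ?_
    have ha : Bar.infinite a ∈ M.map Prod.fst + A := h ▸ Multiset.mem_singleton_self _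
    -- Either the bar at `a` is matched, necessarily with the only bar at `b`, or it is unmatched
    -- and costs `⊤`.
    rcases Multiset.mem_add.1 ha with ha | ha
    · obtain ⟨⟨p, q⟩, hp, rfl⟩ := Multiset.mem_map.1 ha
      have hq : q ∈ ({Bar.infinite b} : Multiset Bar) :=
        h' ▸ Multiset.mem_add.2 (.inl (Multiset.mem_map.2 ⟨_, hp, rfl⟩))
      obtain rfl := Multiset.mem_singleton.1 hq
      exact le_sup_of_le_left (le_sup_of_le_left (le_iSup₂_of_le _ hp le_rfl))
    · exact le_sup_of_le_left (le_sup_of_le_right (le_iSup₂_of_le _ ha le_top))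

end PersistentGH

end

theorem mainTheorem3 :
    ∃ 𝔉 : Set PersistentGH.FiltrationFunctor.{u},
      𝔉 = Set.range PersistentGH.upsilon.{u} ∧
      (∀ Φ ∈ 𝔉, PersistentGH.IsStable 1 Φ) ∧
      ∀ (F : Type v) [Field F] (X Y : PersistentGH.FinMetricSpace.{u}),
        ENNReal.ofReal (PersistentGH.dGH X Y) =
          ⨆ Φ ∈ 𝔉, PersistentGH.dB (PersistentGH.dgm0 F (Φ X)) (PersistentGH.dgm0 F (Φ Y)) := by
  refine ⟨_, rfl, ?_, fun F _ X Y => ?_⟩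
  · rintro _ ⟨Z, rfl⟩
    exact PersistentGH.isStable_upsilon Z
  · have key : ∀ Z : PersistentGH.FinMetricSpace.{u},
        PersistentGH.dB (PersistentGH.dgm0 F (PersistentGH.upsilon Z X))
          (PersistentGH.dgm0 F (PersistentGH.upsilon Z Y)) =
        ENNReal.ofReal |PersistentGH.dGH X Z - PersistentGH.dGH Y Z| := fun Z => by
      rw [PersistentGH.dgm0_of_const F (c := PersistentGH.dGH X Z) fun _ => rfl,
        PersistentGH.dgm0_of_const F (c := PersistentGH.dGH Y Z) fun _ => rfl,
        PersistentGH.dB_infinite]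
    rw [iSup_range]
    simp only [key]
    -- The supremum is attained at `Z = Y`, where `dGH Y Y = 0`.
    refine le_antisymm (le_iSup_of_le Y ?_) (iSup_le fun Z =>
      ENNReal.ofReal_le_ofReal (PersistentGH.abs_dGH_sub_le X Y Z))
    rw [PersistentGH.dGH_self, sub_zero, abs_of_nonneg (PersistentGH.dGH_nonneg X Y)]
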